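/- Consider a port-Hamiltonian differential-algebraic system (pH-DAE) $$E\dot x=(J-R)x+(G-P)u,\qquad y=(G+P)^{\mathsf T}x+(S-N)u,$$ with real matrices $E,J,R\in\mathbb R^{n\times n}$, $G,P\in\mathbb R^{n\times m}$, $S,N\in\mathbb R^{m\times m}$ such that $E=E^{\mathsf T}\ge 0$, $\begin{bmatrix}J&G\\-G^{\mathsf T}&N\end{bmatrix}$ is skew-symmetric and $\begin{bmatrix}R&P\\P^{\mathsf T}&S\end{bmatrix}$ is symmetric positive semidefinite. Assume that the pencil $sE-(J-R)$ is regular, i.e. $\det(sE-(J-R))\not\equiv 0$, and let $H(s)=(G+P)^{\mathsf T}(sE-(J-R))^{-1}(G-P)+(S-N)$ be the transfer function. If $H(s)=H_{\rm sp}(s)+D_0+D_1s$ with real matrices $D_0,D_1\in\mathbb R^{m\times m}$ and a real rational matrix $H_{\rm sp}$ with $\lim_{s\to\infty}H_{\rm sp}(s)=0$, then $H_{\rm p}:=H_{\rm sp}+D_0$ is called the proper part of $H$. The system is in staircase form with dimensions $n_1,n_2,n_3,n_4=n_1$ (any of which may be zero) if, for some orthogonal $T\in\mathbb R^{n\times n}$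 and with respect to block sizes $n_1,n_2,n_3,n_4$, $$T^{\mathsf T}ET=\begin{bmatrix}E_{11}&E_{12}&0&0\\E_{21}&E_{22}&0&0\\0&0&0&0\\0&0&0&0\end{bmatrix},\quad T^{\mathsf T}JT=\begin{bmatrix}J_{11}&J_{12}&J_{13}&J_{14}\\J_{21}&J_{22}&J_{23}&0\\J_{31}&J_{32}&J_{33}&0\\J_{41}&0&0&0\end{bmatrix},\quad T^{\mathsf T}RT=\begin{bmatrix}R_{11}&R_{12}&R_{13}&0\\R_{21}&R_{22}&R_{23}&0\\R_{31}&R_{32}&R_{33}&0\\0&0&0&0\end{bmatrix},\quad T^{\mathsf T}P=\begin{bmatrix}P_1\\P_2\\P_3\\0\end{bmatrix},$$ where $\begin{bmatrix}E_{11}&E_{12}\\E_{21}&E_{22}\end{bmatrix}>0$ and $J_{33}-R_{33}$ and $J_{41}$ are nonsingular. Then the system has a staircase form. Moreover, for every staircase form of the system, with dimensions $n_1,n_2,n_3,n_4$, the proper part $H_{\rm p}$ of $H$ exists and is realized by an implicit pH-ODE of state dimension $n_2$: there are $E_{\rm p},J_{\rm p},R_{\rm p}\in\mathbb R^{n_2\times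 n_2}$, $G_{\rm p},P_{\rm p}\in\mathbb R^{n_2\times m}$, $S_{\rm p},N_{\rm p}\in\mathbb R^{m\times m}$ with $E_{\rm p}=E_{\rm p}^{\mathsf T}>0$, $\begin{bmatrix}J_{\rm p}&G_{\rm p}\\-G_{\rm p}^{\mathsf T}&N_{\rm p}\end{bmatrix}$ skew-symmetric and $\begin{bmatrix}R_{\rm p}&P_{\rm p}\\P_{\rm p}^{\mathsf T}&S_{\rm p}\end{bmatrix}$ symmetric positive semidefinite, such that the system $$E_{\rm p}\dot x_{\rm p}=(J_{\rm p}-R_{\rm p})x_{\rm p}+(G_{\rm p}-P_{\rm p})u,\qquad y_{\rm p}=(G_{\rm p}+P_{\rm p})^{\mathsf T}x_{\rm p}+(S_{\rm p}-N_{\rm p})u$$ has transfer function $(G_{\rm p}+P_{\rm p})^{\mathsf T}(sE_{\rm p}-(J_{\rm p}-R_{\rm p}))^{-1}(G_{\rm p}-P_{\rm p})+(S_{\rm p}-N_{\rm p})=H_{\rm p}(s)$. -/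

import Mathlib

open scoped Matrix

/-- The coefficient matrices of a descriptor system
`E ẋ = (J - R) x + (G - P) u`, `y = (G + P)ᵀ x + (S - N) u`,
with states indexed by `ι` and inputs and outputs indexed by `κ`. -/
structure DescriptorSystem (ι κ : Type*) where
  E : Matrix ι ι ℝ
  J : Matrix ι ι ℝ
  R : Matrix ι ι ℝ
  G : Matrix ι κ ℝ
  P : Matrix ι κ ℝ
  S : Matrix κ κ ℝ
  N : Matrix κ κ ℝ

namespace DescriptorSystem

/-- The port-Hamiltonian structure conditions: `E` is symmetric positive semidefinite,
`[J, G; -Gᵀ, N]` is skew-symmetric and `[R, P; Pᵀ, S]` is symmetric positive semidefinite. -/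
structure IsPortHamiltonian {ι κ : Type*} (sys : DescriptorSystem ι κ) : Prop where
  posSemidef_E : sys.E.PosSemidef
  skew : (Matrix.fromBlocks sys.J sys.G (-sys.Gᵀ) sys.N)ᵀ =
    -Matrix.fromBlocks sys.J sys.G (-sys.Gᵀ) sys.N
  posSemidef_W : (Matrix.fromBlocks sys.R sys.P sys.Pᵀ sys.S).PosSemidef

/-- The matrix pencil `s E - (J - R)`, a matrix of real polynomials in `s`. -/
noncomputable def pencil {ι κ : Type*} (sys : DescriptorSystem ι κ) :
    Matrix ι ι (Polynomial ℝ) :=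
  (Polynomial.X : Polynomial ℝ) • sys.E.map Polynomial.C - (sys.J - sys.R).map Polynomial.C

/-- The pencil `s E - (J - R)` is regular: its determinant is not the zero polynomial. -/
def IsRegular {ι κ : Type*} [Fintype ι] [DecidableEq ι] (sys : DescriptorSystem ι κ) : Prop :=
  sys.pencil.det ≠ 0

/-- The transfer function `(G + P)ᵀ (s E - (J - R))⁻¹ (G - P) + (S - N)`,
a matrix of real rational functions in `s`. -/
noncomputable def transferFunction {ι κ : Type*} [Fintype ι] [DecidableEq ι]
    (sys : DescriptorSystem ι κ) : Matrix κ κ (RatFunc ℝ) :=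
  (sys.G + sys.P)ᵀ.map RatFunc.C *
      (sys.pencil.map (algebraMap (Polynomial ℝ) (RatFunc ℝ)))⁻¹ *
      (sys.G - sys.P).map RatFunc.C +
    (sys.S - sys.N).map RatFunc.C

/-- An orthogonal change of state variables `x = T x̃` brings the system into staircase form, with
blocks `x̃ = (x₁, x₂, x₃, x₄)` of sizes `n₁, n₂, n₃, n₄`, where `n₄ = n₁`:
```
    [E₁₁ E₁₂ 0 0]        [J₁₁ J₁₂ J₁₃ J₁₄]        [R₁₁ R₁₂ R₁₃ 0]        [P₁]
E ~ [E₂₁ E₂₂ 0 0]    J ~ [J₂₁ J₂₂ J₂₃  0 ]    R ~ [R₂₁ R₂₂ R₂₃ 0]    P ~ [P₂]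
    [ 0   0  0 0]        [J₃₁ J₃₂ J₃₃  0 ]        [R₃₁ R₃₂ R₃₃ 0]        [P₃]
    [ 0   0  0 0]        [J₄₁  0   0   0 ]        [ 0   0   0  0]        [0 ]
```
where `[E₁₁ E₁₂; E₂₁ E₂₂]` is positive definite and `J₃₃ - R₃₃` and `J₄₁` are nonsingular.
Any of the blocks may be absent (of size zero). -/
def HasStaircaseForm {ι κ : Type*} [Fintype ι] [DecidableEq ι] (sys : DescriptorSystem ι κ)
    (n₁ n₂ n₃ : ℕ) : Prop :=
  ∃ T : Matrix ι ((Fin n₁ ⊕ Fin n₂) ⊕ (Fin n₃ ⊕ Fin n₁)) ℝ,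
    Tᵀ * T = 1 ∧ T * Tᵀ = 1 ∧
    (∃ E₀ : Matrix (Fin n₁ ⊕ Fin n₂) (Fin n₁ ⊕ Fin n₂) ℝ,
      E₀.PosDef ∧ Tᵀ * sys.E * T = Matrix.fromBlocks E₀ 0 0 0) ∧
    (∃ J₁₁ J₁₂ J₁₃ J₁₄ J₂₁ J₂₂ J₂₃ J₃₁ J₃₂ J₃₃ J₄₁ R₁₁ R₁₂ R₁₃ R₂₁ R₂₂ R₂₃ R₃₁ R₃₂ R₃₃,
      Tᵀ * sys.J * T =
        Matrix.fromBlocks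
          (Matrix.fromBlocks J₁₁ J₁₂ J₂₁ J₂₂) (Matrix.fromBlocks J₁₃ J₁₄ J₂₃ 0)
          (Matrix.fromBlocks J₃₁ J₃₂ J₄₁ 0) (Matrix.fromBlocks J₃₃ 0 0 0) ∧
      Tᵀ * sys.R * T =
        Matrix.fromBlocks
          (Matrix.fromBlocks R₁₁ R₁₂ R₂₁ R₂₂) (Matrix.fromBlocks R₁₃ 0 R₂₃ 0)
          (Matrix.fromBlocks R₃₁ R₃₂ 0 0) (Matrix.fromBlocks R₃₃ 0 0 0) ∧
      IsUnit (J₃₃ - R₃₃) ∧ IsUnit J₄₁) ∧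
    (∃ P₁ P₂ P₃,
      Tᵀ * sys.P =
        Matrix.fromRows (Matrix.fromRows P₁ P₂) (Matrix.fromRows P₃ 0))

end DescriptorSystem

/-- A real rational matrix `H` is strictly proper if `H(s) → 0` as `s → ∞` in `ℂ`. -/
def IsStrictlyProper {κ : Type*} (H : Matrix κ κ (RatFunc ℝ)) : Prop :=
  ∀ i j, Filter.Tendsto (fun s : ℂ => (H i j).eval (algebraMap ℝ ℂ) s)
    (Bornology.cobounded ℂ) (nhds 0)

/-- `Hp` is the proper part of the real rational matrix `H`: there is a decomposition
`H(s) = Hsp(s) + D₀ + s D₁` with `Hsp` strictly proper and constant real matrices `D₀`, `D₁`, and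
`Hp = Hsp + D₀`. -/
def IsProperPart {κ : Type*} (H Hp : Matrix κ κ (RatFunc ℝ)) : Prop :=
  ∃ (Hsp : Matrix κ κ (RatFunc ℝ)) (D₀ D₁ : Matrix κ κ ℝ),
    IsStrictlyProper Hsp ∧
    H = Hsp + D₀.map RatFunc.C + (RatFunc.X : RatFunc ℝ) • D₁.map RatFunc.C ∧
    Hp = Hsp + D₀.map RatFunc.C

/-!
With `A = J - R`, the states in `ker E` at which `A` fails to act invertibly form the subspace
`K = {x ∈ ker E | R x = 0, J x ⊥ ker E}`: if `xᵀ A x = 0` then `xᵀ R x = 0`, so semidefiniteness of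
`[R, P; Pᵀ, S]` forces `R x = 0` and `Pᵀ x = 0`. Regularity makes `J` injective on `K`. The
orthogonal decomposition of the state space into `J K`, its complement in the range of `E`, the
complement of `K` in `ker E`, and `K` gives a staircase form
(`DescriptorSystem.IsPortHamiltonian.exists_hasStaircaseForm`).

Now let any staircase form be given. Its fourth block row fixes `x₁ = X u`, the third one
expresses `x₃` through `x₂` and `u`, and the first one merely determines the multiplier `x₄`. With
`x₂ = z + Y u`, where `E₂₂ Y = -E₂₁ X`, the ansatz becomes `x = Q z + L u + T₄ x₄` with
`Qᵀ E L = 0`. Since the system reads `[E x'; -y] = (Γ - W) [x; u]` with `Γ = [J, G; -Gᵀ, N]`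
skew-symmetric and `W = [R, P; Pᵀ, S]` positive semidefinite, multiplying by `[Q, L; 0, 1]ᵀ` from
the left eliminates `x₄` and yields a system whose structure matrices are the congruences of `Γ`
and `W` with `[Q, L; 0, 1]`. It is again port-Hamiltonian
(`DescriptorSystem.IsPortHamiltonian.congruence`), and its transfer function differs from the given
one by exactly `s Lᵀ E L` (`Matrix.mul_inv_mul_eq_reduced`). As `Qᵀ E Q = E₂₂` is nonsingular, this
transfer function is the sum of a constant and a strictly proper function
(`DescriptorSystem.isStrictlyProper_of_det_ne_zero`), hence the proper part.
-/

/-! ### Strict properness of rational transfer functions -/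

/-- A quotient of real polynomials, evaluated in lowest terms on `ℂ`, tends to `0` at infinity if the
degree of the numerator is smaller than that of the denominator. -/
theorem RatFunc.tendsto_eval_cobounded_of_degree_lt {p q : Polynomial ℝ} (hq : q ≠ 0)
    (h : p.degree < q.degree) :
    Filter.Tendsto (fun s : ℂ => (algebraMap (Polynomial ℝ) (RatFunc ℝ) p /
        algebraMap (Polynomial ℝ) (RatFunc ℝ) q).eval (algebraMap ℝ ℂ) s)
      (Bornology.cobounded ℂ) (nhds 0) := by
  set f : RatFunc ℝ := algebraMap (Polynomial ℝ) (RatFunc ℝ) p /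
    algebraMap (Polynomial ℝ) (RatFunc ℝ) q with hf
  -- Cancelling common factors does not change the difference of the degrees.
  have hdeg : f.num.degree < f.denom.degree := by
    have hcross : f.num * q = p * f.denom := by
      have h1 : algebraMap (Polynomial ℝ) (RatFunc ℝ) f.num / algebraMap _ _ f.denom =
          algebraMap _ _ p / algebraMap _ _ q := RatFunc.num_div_denom f
      rw [div_eq_div_iff (RatFunc.algebraMap_ne_zero f.denom_ne_zero)
        (RatFunc.algebraMap_ne_zero hq), ← map_mul, ← map_mul] at h1
      exact RatFunc.algebraMap_injective ℝ h1
    have h1 := congrArg Polynomial.degree hcross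
    rw [Polynomial.degree_mul, Polynomial.degree_mul, add_comm p.degree] at h1
    by_contra! hle
    have hd : f.denom.degree ≠ ⊥ := Polynomial.degree_ne_bot.mpr f.denom_ne_zero
    have hlt : f.denom.degree + p.degree < f.denom.degree + q.degree :=
      WithBot.add_lt_add_left hd h
    exact absurd (hlt.trans_le (add_le_add_left hle _)) (by rw [h1]; exact lt_irrefl _)
  have := Polynomial.isLittleO_cobounded_of_degree_lt (R := ℂ)
    (P := f.num.map (algebraMap ℝ ℂ)) (Q := f.denom.map (algebraMap ℝ ℂ)) (by
      rwa [Polynomial.degree_map, Polynomial.degree_map])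
  simpa only [RatFunc.eval, Polynomial.eval₂_eq_eval_map] using this.tendsto_div_nhds_zero

namespace Matrix

/-- The entries of the adjugate of a `k × k` matrix pencil have degree less than `k`: such an entry
is the determinant of a pencil whose leading coefficient matrix has a zero row. -/
theorem adjugate_X_smul_add_mem_degreeLT {ν : Type*} [Fintype ν] [DecidableEq ν]
    (E A : Matrix ν ν ℝ) (i j : ν) :
    ((Polynomial.X : Polynomial ℝ) • E.map Polynomial.C + A.map Polynomial.C).adjugate i j
      ∈ Polynomial.degreeLT ℝ (Fintype.card ν) := by
  have hrow : ((Polynomial.X : Polynomial ℝ) • E.map Polynomial.C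
        + A.map Polynomial.C).updateRow j (Pi.single i 1) =
      (Polynomial.X : Polynomial ℝ) • (E.updateRow j 0).map Polynomial.C +
        (A.updateRow j (Pi.single i 1)).map Polynomial.C := by
    ext a b : 2
    by_cases ha : a = j
    · subst ha
      by_cases hb : b = i
      · subst hb; simp
      · simp [hb]
    · simp [ha]
  rw [adjugate_apply, hrow, Polynomial.mem_degreeLT]
  refine lt_of_le_of_ne (Polynomial.degree_le_of_natDegree_le
    (Polynomial.natDegree_det_X_add_C_le _ _)) fun h => ?_
  have h0 := Polynomial.coeff_det_X_add_C_card (E.updateRow j 0) (A.updateRow j (Pi.single i 1))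
  rw [det_eq_zero_of_row_eq_zero (A := E.updateRow j 0) j (fun k => by simp)] at h0
  exact Polynomial.coeff_ne_zero_of_eq_degree h h0

theorem map_ratFuncC_eq {α β : Type*} (M : Matrix α β ℝ) : M.map (RatFunc.C (K := ℝ)) =
    (M.map Polynomial.C).map (algebraMap (Polynomial ℝ) (RatFunc ℝ)) := by
  ext; simp [RatFunc.algebraMap_C]

end Matrix

namespace DescriptorSystem

variable {ι κ ν : Type*}

theorem pencil_map_algebraMap (sys : DescriptorSystem ι κ) :
    sys.pencil.map (algebraMap (Polynomial ℝ) (RatFunc ℝ)) =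
      (RatFunc.X : RatFunc ℝ) • sys.E.map RatFunc.C - (sys.J - sys.R).map RatFunc.C := by
  ext i j
  simp [pencil, RatFunc.algebraMap_X, RatFunc.algebraMap_C]
  exact mul_comm _ _

theorem IsRegular.isUnit_pencil [Fintype ι] [DecidableEq ι] {sys : DescriptorSystem ι κ}
    (h : sys.IsRegular) :
    IsUnit (sys.pencil.map (algebraMap (Polynomial ℝ) (RatFunc ℝ))) := by
  rw [Matrix.isUnit_iff_isUnit_det, isUnit_iff_ne_zero, ← RingHom.mapMatrix_apply,
    ← RingHom.map_det]
  exact RatFunc.algebraMap_ne_zero h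

theorem pencil_eq_add [Fintype ι] [DecidableEq ι] (sys : DescriptorSystem ι κ) :
    sys.pencil = (Polynomial.X : Polynomial ℝ) • sys.E.map Polynomial.C +
      (-(sys.J - sys.R)).map Polynomial.C := by
  ext i j : 2
  simp [pencil]
  ring

theorem degree_det_pencil [Fintype ι] [DecidableEq ι] {sys : DescriptorSystem ι κ}
    (hE : sys.E.det ≠ 0) : sys.pencil.det.degree = Fintype.card ι := by
  rw [pencil_eq_add]
  refine le_antisymm (Polynomial.degree_le_of_natDegree_le
    (Polynomial.natDegree_det_X_add_C_le _ _)) (Polynomial.le_degree_of_ne_zero ?_)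
  rwa [Polynomial.coeff_det_X_add_C_card]

theorem isRegular_of_det_ne_zero [Fintype ι] [DecidableEq ι] {sys : DescriptorSystem ι κ}
    (hE : sys.E.det ≠ 0) : sys.IsRegular := by
  intro h
  have := degree_det_pencil hE
  rw [h, Polynomial.degree_zero] at this
  exact WithBot.bot_ne_natCast _ this

/-- If `E` is nonsingular, the entries of `(G + P)ᵀ (s E - (J - R))⁻¹ (G - P)` are quotients with
denominator `det (s E - (J - R))` of degree equal to the number of states, and with numerators of
smaller degree by `Matrix.adjugate_X_smul_add_mem_degreeLT`. -/
theorem isStrictlyProper_of_det_ne_zero [Fintype ι] [DecidableEq ι]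
    {sys : DescriptorSystem ι κ} (hE : sys.E.det ≠ 0) :
    IsStrictlyProper ((sys.G + sys.P)ᵀ.map RatFunc.C *
      (sys.pencil.map (algebraMap (Polynomial ℝ) (RatFunc ℝ)))⁻¹ *
      (sys.G - sys.P).map RatFunc.C) := by
  intro i j
  set p : Polynomial ℝ := ((sys.G + sys.P)ᵀ.map Polynomial.C * sys.pencil.adjugate *
    (sys.G - sys.P).map Polynomial.C) i j with hp
  have hentry : ((sys.G + sys.P)ᵀ.map RatFunc.C *
      (sys.pencil.map (algebraMap (Polynomial ℝ) (RatFunc ℝ)))⁻¹ *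
      (sys.G - sys.P).map RatFunc.C) i j =
      algebraMap (Polynomial ℝ) (RatFunc ℝ) p /
        algebraMap (Polynomial ℝ) (RatFunc ℝ) sys.pencil.det := by
    rw [Matrix.inv_def, ← RingHom.mapMatrix_apply, ← RingHom.map_det, ← RingHom.map_adjugate,
      Ring.inverse_eq_inv', Matrix.map_ratFuncC_eq, Matrix.map_ratFuncC_eq,
      RingHom.mapMatrix_apply, Matrix.mul_smul, Matrix.smul_mul,
      ← Matrix.map_mul, ← Matrix.map_mul, Matrix.smul_apply, Matrix.map_apply, smul_eq_mul,
      div_eq_inv_mul]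
  have hdeg : p ∈ Polynomial.degreeLT ℝ (Fintype.card ι) := by
    rw [hp, Matrix.mul_apply]
    refine Submodule.sum_mem _ fun l _ => ?_
    rw [Matrix.mul_apply, Finset.sum_mul]
    refine Submodule.sum_mem _ fun k _ => ?_
    rw [Matrix.map_apply, Matrix.map_apply, mul_comm, ← Polynomial.smul_eq_C_mul,
      ← Polynomial.smul_eq_C_mul, pencil_eq_add]
    exact Submodule.smul_mem _ _ (Submodule.smul_mem _ _
      (Matrix.adjugate_X_smul_add_mem_degreeLT _ _ _ _))
  simp only [hentry]
  refine RatFunc.tendsto_eval_cobounded_of_degree_lt (isRegular_of_det_ne_zero hE) ?_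
  rw [degree_det_pencil hE]
  exact Polynomial.mem_degreeLT.mp hdeg

end DescriptorSystem

/-! ### Congruence reduction of port-Hamiltonian systems -/

namespace DescriptorSystem

variable {ι κ ν : Type*}

/-- The system with state `z` obtained from the ansatz `x = Q z + L u`: the structure matrices
`[J, G; -Gᵀ, N]` and `[R, P; Pᵀ, S]` undergo the congruence with `[Q, L; 0, 1]`, and `E` the
congruence with `Q`. -/
def congruence [Fintype ι] (sys : DescriptorSystem ι κ) (Q : Matrix ι ν ℝ) (L : Matrix ι κ ℝ) :
    DescriptorSystem ν κ where
  E := Qᵀ * sys.E * Q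
  J := Qᵀ * sys.J * Q
  R := Qᵀ * sys.R * Q
  G := Qᵀ * (sys.J * L + sys.G)
  P := Qᵀ * (sys.R * L + sys.P)
  S := Lᵀ * (sys.R * L + sys.P) + (sys.Pᵀ * L + sys.S)
  N := Lᵀ * (sys.J * L + sys.G) + (-sys.Gᵀ * L + sys.N)

theorem IsPortHamiltonian.transpose_J {sys : DescriptorSystem ι κ} (h : sys.IsPortHamiltonian) :
    sys.Jᵀ = -sys.J := by
  have := h.skew
  rw [Matrix.fromBlocks_transpose, Matrix.fromBlocks_neg, Matrix.fromBlocks_inj] at this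
  exact this.1

theorem IsPortHamiltonian.transpose_R {sys : DescriptorSystem ι κ} (h : sys.IsPortHamiltonian) :
    sys.Rᵀ = sys.R := by
  have := h.posSemidef_W.isHermitian
  rw [Matrix.IsHermitian, Matrix.conjTranspose_eq_transpose_of_trivial,
    Matrix.fromBlocks_transpose, Matrix.fromBlocks_inj] at this
  exact this.1

theorem IsPortHamiltonian.transpose_E {sys : DescriptorSystem ι κ} (h : sys.IsPortHamiltonian) :
    sys.Eᵀ = sys.E := by
  simpa [Matrix.IsHermitian, Matrix.conjTranspose_eq_transpose_of_trivial] using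
    h.posSemidef_E.isHermitian

theorem IsPortHamiltonian.transpose_mul_J_mul {α β : Type*} [Fintype ι]
    {sys : DescriptorSystem ι κ} (h : sys.IsPortHamiltonian) (V : Matrix ι α ℝ)
    (W : Matrix ι β ℝ) : (Vᵀ * sys.J * W)ᵀ = -(Wᵀ * sys.J * V) := by
  rw [Matrix.transpose_mul, Matrix.transpose_mul, Matrix.transpose_transpose, h.transpose_J,
    Matrix.neg_mul, Matrix.mul_neg, Matrix.mul_assoc]

theorem IsPortHamiltonian.transpose_mul_R_mul {α β : Type*} [Fintype ι]
    {sys : DescriptorSystem ι κ} (h : sys.IsPortHamiltonian) (V : Matrix ι α ℝ)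
    (W : Matrix ι β ℝ) : (Vᵀ * sys.R * W)ᵀ = Wᵀ * sys.R * V := by
  rw [Matrix.transpose_mul, Matrix.transpose_mul, Matrix.transpose_transpose, h.transpose_R,
    Matrix.mul_assoc]

theorem IsPortHamiltonian.congruence [Fintype ι] [Fintype κ] [DecidableEq κ] [Fintype ν]
    {sys : DescriptorSystem ι κ} (h : sys.IsPortHamiltonian) (Q : Matrix ι ν ℝ)
    (L : Matrix ι κ ℝ) : (sys.congruence Q L).IsPortHamiltonian := by
  have hJ := h.transpose_J
  have hR := h.transpose_R
  have hΓ : Matrix.fromBlocks (sys.congruence Q L).J (sys.congruence Q L).G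
      (-(sys.congruence Q L).Gᵀ) (sys.congruence Q L).N =
      (Matrix.fromBlocks Q L (0 : Matrix κ ν ℝ) (1 : Matrix κ κ ℝ))ᵀ *
        Matrix.fromBlocks sys.J sys.G (-sys.Gᵀ) sys.N *
        Matrix.fromBlocks Q L (0 : Matrix κ ν ℝ) (1 : Matrix κ κ ℝ) := by
    simp [DescriptorSystem.congruence, Matrix.fromBlocks_transpose, Matrix.fromBlocks_multiply,
      Matrix.mul_add, Matrix.add_mul, Matrix.mul_assoc, hJ]
    constructor <;> abel
  have hW : Matrix.fromBlocks (sys.congruence Q L).R (sys.congruence Q L).P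
      (sys.congruence Q L).Pᵀ (sys.congruence Q L).S =
      (Matrix.fromBlocks Q L (0 : Matrix κ ν ℝ) (1 : Matrix κ κ ℝ))ᵀ *
        Matrix.fromBlocks sys.R sys.P sys.Pᵀ sys.S *
        Matrix.fromBlocks Q L (0 : Matrix κ ν ℝ) (1 : Matrix κ κ ℝ) := by
    simp [DescriptorSystem.congruence, Matrix.fromBlocks_transpose, Matrix.fromBlocks_multiply,
      Matrix.mul_add, Matrix.add_mul, Matrix.mul_assoc, hR]
    abel
  refine ⟨?_, ?_, ?_⟩
  · simpa [DescriptorSystem.congruence, Matrix.conjTranspose_eq_transpose_of_trivial] using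
      h.posSemidef_E.conjTranspose_mul_mul_same Q
  · rw [hΓ, Matrix.transpose_mul, Matrix.transpose_mul, h.skew]
    simp [Matrix.mul_assoc]
  · rw [hW]
    simpa [Matrix.conjTranspose_eq_transpose_of_trivial] using
      h.posSemidef_W.conjTranspose_mul_mul_same (Matrix.fromBlocks Q L 0 1)

end DescriptorSystem

/-! ### Elimination of algebraic equations from the transfer function -/

/-- Elimination of the algebraic equations of `s E x = A x + B u`, `y = C x`, over a field. The
ansatz is `x = Q z + L u + M w`. The equations tested with `K` are algebraic and hold identically,
those tested with `Q` determine `z`, and those tested with `U` determine the multiplier `w`; by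
`hV` these tests detect every vector. The equation tested with `L` then gives the contribution
`C M w = Lᵀ A M w` of the multiplier to the output, whose only term that is not proper in `s` is
`s Lᵀ E L u`. -/
theorem Matrix.mul_inv_mul_eq_reduced {F ι κ ν μ o : Type*} [Field F] [Fintype ι] [DecidableEq ι]
    [Fintype ν] [DecidableEq ν] [Fintype μ] [DecidableEq μ] [Fintype o]
    (s : F) {E A : Matrix ι ι F} {B : Matrix ι κ F} {C : Matrix κ ι F}
    {Q V₂ : Matrix ι ν F} {L : Matrix ι κ F} {M U V₁ : Matrix ι μ F} {K V₃ : Matrix ι o F}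
    (hEM : E * M = 0) (hKE : Kᵀ * E = 0) (hKAQ : Kᵀ * (A * Q) = 0) (hKAM : Kᵀ * (A * M) = 0)
    (hKB : Kᵀ * (A * L + B) = 0) (hQEL : Qᵀ * (E * L) = 0) (hLEQ : Lᵀ * (E * Q) = 0)
    (hQAM : Qᵀ * (A * M) = 0) (hUAM : IsUnit (Uᵀ * (A * M)))
    (hV : V₁ * Uᵀ + V₂ * Qᵀ + V₃ * Kᵀ = 1) (hCM : C * M = Lᵀ * (A * M))
    (hreg : IsUnit (s • E - A)) (hred : IsUnit (s • (Qᵀ * E * Q) - Qᵀ * A * Q)) :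
    C * (s • E - A)⁻¹ * B =
      (C - Lᵀ * A) * Q * (s • (Qᵀ * E * Q) - Qᵀ * A * Q)⁻¹ * (Qᵀ * (A * L + B)) +
        (C * L - Lᵀ * (A * L + B)) + s • (Lᵀ * E * L) := by
  rw [Matrix.isUnit_iff_isUnit_det] at hUAM hreg hred
  set Z := (s • (Qᵀ * E * Q) - Qᵀ * A * Q)⁻¹ * (Qᵀ * (A * L + B)) with hZ
  have hZeq : (s • (Qᵀ * E * Q) - Qᵀ * A * Q) * Z = Qᵀ * (A * L + B) := by
    rw [hZ, Matrix.mul_nonsing_inv_cancel_left _ _ hred]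
  set W := (Uᵀ * (A * M))⁻¹ * (Uᵀ * ((s • E - A) * (Q * Z + L) - B)) with hW
  have hWeq : Uᵀ * (A * M) * W = Uᵀ * ((s • E - A) * (Q * Z + L) - B) := by
    rw [hW, Matrix.mul_nonsing_inv_cancel_left _ _ hUAM]
  -- The residual of the state equation at `x = Q Z + L + M W` (recall `E M = 0`).
  set r := (s • E - A) * (Q * Z + L) - B - A * M * W with hr
  have hUr : Uᵀ * r = 0 := by
    rw [hr, Matrix.mul_sub, ← hWeq, Matrix.mul_assoc Uᵀ, sub_self]
  have hr' : r = s • (E * Q * Z) + s • (E * L) - A * Q * Z - (A * L + B) - A * M * W := by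
    rw [hr]
    simp only [Matrix.sub_mul, Matrix.mul_add, Matrix.smul_mul, Matrix.mul_assoc]
    abel
  have hQr : Qᵀ * r = 0 := by
    have h1 : Qᵀ * r = (s • (Qᵀ * E * Q) - Qᵀ * A * Q) * Z - Qᵀ * (A * L + B)
        + s • (Qᵀ * (E * L)) - Qᵀ * (A * M) * W := by
      rw [hr']
      simp only [Matrix.mul_sub, Matrix.sub_mul, Matrix.mul_add, Matrix.smul_mul, Matrix.mul_smul,
        Matrix.mul_assoc]
      abel
    rw [h1, hZeq, hQEL, hQAM]; simp
  have hKr : Kᵀ * r = 0 := by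
    have h1 : Kᵀ * r = s • (Kᵀ * E * (Q * Z)) + s • (Kᵀ * E * L) - Kᵀ * (A * Q) * Z
        - Kᵀ * (A * L + B) - Kᵀ * (A * M) * W := by
      rw [hr']
      simp only [Matrix.mul_sub, Matrix.mul_add, Matrix.mul_smul, Matrix.mul_assoc]
    rw [h1, hKE, hKAQ, hKB, hKAM]; simp
  have hr0 : r = 0 := by
    rw [← Matrix.one_mul r, ← hV]
    simp only [Matrix.add_mul, Matrix.mul_assoc, hUr, hQr, hKr, Matrix.mul_zero, add_zero]
  have hstate : (s • E - A) * (Q * Z + L + M * W) = B := by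
    have h1 : (s • E - A) * (Q * Z + L + M * W) - B = r + s • (E * M * W) := by
      rw [hr]
      simp only [Matrix.sub_mul, Matrix.mul_add, Matrix.smul_mul, Matrix.mul_assoc]
      abel
    rw [← sub_eq_zero, h1, hr0, hEM]; simp
  have hinv : (s • E - A)⁻¹ * B = Q * Z + L + M * W := by
    rw [← hstate, Matrix.nonsing_inv_mul_cancel_left _ _ hreg]
  have hLr : s • (Lᵀ * E * L) - Lᵀ * A * Q * Z - Lᵀ * (A * L + B) = Lᵀ * (A * M) * W := by
    have h1 : Lᵀ * r = s • (Lᵀ * (E * Q) * Z) + s • (Lᵀ * E * L) - Lᵀ * A * Q * Z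
        - Lᵀ * (A * L + B) - Lᵀ * (A * M) * W := by
      rw [hr']
      simp only [Matrix.mul_sub, Matrix.mul_add, Matrix.mul_smul, Matrix.mul_assoc]
    rw [hr0, hLEQ, Matrix.mul_zero, Matrix.zero_mul, smul_zero, zero_add] at h1
    exact sub_eq_zero.mp h1.symm
  have hCMW : C * (M * W) = s • (Lᵀ * E * L) - Lᵀ * A * Q * Z - Lᵀ * (A * L + B) := by
    rw [hLr, ← Matrix.mul_assoc, hCM]
  rw [Matrix.mul_assoc C, hinv, Matrix.mul_assoc _ _ (Qᵀ * (A * L + B)), ← hZ, Matrix.mul_add,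
    Matrix.mul_add, hCMW]
  simp only [Matrix.sub_mul, Matrix.mul_assoc]
  abel

namespace DescriptorSystem

variable {ι κ ν : Type*}

/-- Sufficient conditions for the congruence with `[Q, L; 0, 1]` to realize the proper part of the
transfer function. The improper part is `s Lᵀ E L`. -/
theorem isProperPart_congruence {μ o : Type*} [Fintype ι] [DecidableEq ι] [Fintype ν]
    [DecidableEq ν] [Fintype μ] [DecidableEq μ] [Fintype o]
    {sys : DescriptorSystem ι κ} (hsys : sys.IsPortHamiltonian) (hreg : sys.IsRegular)
    {Q V₂ : Matrix ι ν ℝ} {L : Matrix ι κ ℝ} {M U V₁ : Matrix ι μ ℝ} {K V₃ : Matrix ι o ℝ}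
    (hEM : sys.E * M = 0) (hEK : sys.E * K = 0) (hKAQ : Kᵀ * ((sys.J - sys.R) * Q) = 0)
    (hKAM : Kᵀ * ((sys.J - sys.R) * M) = 0)
    (hKB : Kᵀ * ((sys.J - sys.R) * L + (sys.G - sys.P)) = 0) (hQEL : Qᵀ * (sys.E * L) = 0)
    (hQAM : Qᵀ * ((sys.J - sys.R) * M) = 0) (hUAM : IsUnit (Uᵀ * ((sys.J - sys.R) * M)))
    (hV : V₁ * Uᵀ + V₂ * Qᵀ + V₃ * Kᵀ = 1)
    (hCM : (sys.G + sys.P)ᵀ * M = Lᵀ * ((sys.J - sys.R) * M))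
    (hEQ : (Qᵀ * sys.E * Q).det ≠ 0) :
    IsProperPart sys.transferFunction (sys.congruence Q L).transferFunction := by
  have hKE : Kᵀ * sys.E = 0 := by
    have := congrArg Matrix.transpose hEK
    rwa [Matrix.transpose_mul, hsys.transpose_E, Matrix.transpose_zero] at this
  have hLEQ : Lᵀ * (sys.E * Q) = 0 := by
    have := congrArg Matrix.transpose hQEL
    rwa [Matrix.transpose_mul, Matrix.transpose_mul, hsys.transpose_E, Matrix.transpose_zero,
      Matrix.transpose_transpose, Matrix.mul_assoc] at this
  have hB : (sys.congruence Q L).G - (sys.congruence Q L).P =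
      Qᵀ * ((sys.J - sys.R) * L + (sys.G - sys.P)) := by
    simp only [congruence, Matrix.sub_mul, Matrix.mul_add, Matrix.mul_sub]
    abel
  have hC : ((sys.congruence Q L).G + (sys.congruence Q L).P)ᵀ =
      ((sys.G + sys.P)ᵀ - Lᵀ * (sys.J - sys.R)) * Q := by
    simp only [congruence, Matrix.transpose_add, Matrix.transpose_mul, Matrix.transpose_transpose,
      hsys.transpose_J, hsys.transpose_R, Matrix.sub_mul, Matrix.mul_sub, Matrix.add_mul,
      Matrix.mul_neg, Matrix.neg_mul]
    abel
  have hD : (sys.congruence Q L).S - (sys.congruence Q L).N =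
      ((sys.G + sys.P)ᵀ * L - Lᵀ * ((sys.J - sys.R) * L + (sys.G - sys.P))) +
        (sys.S - sys.N) := by
    simp only [congruence, Matrix.transpose_add, Matrix.sub_mul, Matrix.mul_sub, Matrix.add_mul,
      Matrix.mul_add, Matrix.neg_mul]
    abel
  have hA : (sys.congruence Q L).J - (sys.congruence Q L).R = Qᵀ * (sys.J - sys.R) * Q := by
    simp only [congruence, Matrix.sub_mul, Matrix.mul_sub]
  have hE : (sys.congruence Q L).E = Qᵀ * sys.E * Q := rfl
  have hred : (sys.congruence Q L).IsRegular := isRegular_of_det_ne_zero hEQ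
  refine ⟨_, (sys.congruence Q L).S - (sys.congruence Q L).N, Lᵀ * sys.E * L,
    isStrictlyProper_of_det_ne_zero (sys := sys.congruence Q L) hEQ, ?_, rfl⟩
  have hmain := Matrix.mul_inv_mul_eq_reduced (F := RatFunc ℝ) RatFunc.X (E := sys.E.map RatFunc.C)
    (A := (sys.J - sys.R).map RatFunc.C) (B := (sys.G - sys.P).map RatFunc.C)
    (C := (sys.G + sys.P)ᵀ.map RatFunc.C) (Q := Q.map RatFunc.C) (L := L.map RatFunc.C)
    (M := M.map RatFunc.C) (U := U.map RatFunc.C) (K := K.map RatFunc.C)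
    (V₁ := V₁.map RatFunc.C) (V₂ := V₂.map RatFunc.C) (V₃ := V₃.map RatFunc.C)
  have hp1 := hreg.isUnit_pencil
  have hp2 := hred.isUnit_pencil
  rw [pencil_map_algebraMap] at hp1 hp2
  rw [hE, hA] at hp2
  simp only [← Matrix.transpose_map, ← Matrix.map_mul, ← Matrix.map_add _ (map_add _),
    ← Matrix.map_sub _ (map_sub _), hEM, hKE, hKAQ, hKAM, hKB, hQEL, hLEQ, hQAM, hV, hCM,
    Matrix.map_zero _ (map_zero (RatFunc.C (K := ℝ))),
    Matrix.map_one _ (map_zero (RatFunc.C (K := ℝ))) (map_one (RatFunc.C (K := ℝ))),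
    forall_const] at hmain
  have h := hmain (by simpa using hUAM.map (RatFunc.C (K := ℝ)).mapMatrix) hp1 hp2
  rw [transferFunction, pencil_map_algebraMap, h, pencil_map_algebraMap, hB, hC, hD, hE, hA]
  simp only [Matrix.map_add _ (map_add (RatFunc.C (K := ℝ)))]
  abel

end DescriptorSystem

/-! ### Orthogonal splittings and semidefinite matrices -/

theorem Matrix.transpose_fromCols_mul_mul_fromCols {ι α β γ δ : Type*} [Fintype ι]
    (M : Matrix ι ι ℝ) (A : Matrix ι α ℝ) (B : Matrix ι β ℝ) (C : Matrix ι γ ℝ)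
    (D : Matrix ι δ ℝ) :
    (fromCols A B)ᵀ * M * fromCols C D =
      fromBlocks (Aᵀ * M * C) (Aᵀ * M * D) (Bᵀ * M * C) (Bᵀ * M * D) := by
  rw [transpose_fromCols, fromRows_mul, fromRows_mul_fromCols]

namespace Matrix

variable {ι κ : Type*}

/-- Every real matrix `A` admits an orthogonal matrix `[B C]` such that `A * C = 0` and `A` is
injective on the span of the columns of `B`; so the columns of `C` span the kernel of `A`. The
columns are eigenvectors of `Aᵀ * A`, sorted by whether the eigenvalue is zero. -/
theorem exists_orthogonal_kernel_splitting [Fintype ι] [Fintype κ] [DecidableEq κ]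
    (A : Matrix ι κ ℝ) :
    ∃ (p q : ℕ) (B : Matrix κ (Fin p) ℝ) (C : Matrix κ (Fin q) ℝ),
      Bᵀ * B = 1 ∧ Bᵀ * C = 0 ∧ Cᵀ * B = 0 ∧ Cᵀ * C = 1 ∧ B * Bᵀ + C * Cᵀ = 1 ∧
      A * C = 0 ∧ ∀ x, A *ᵥ (B *ᵥ x) = 0 → x = 0 := by
  classical
  have hH : (Aᵀ * A).IsHermitian := by
    simpa [conjTranspose_eq_transpose_of_trivial] using isHermitian_conjTranspose_mul_self A
  set V : Matrix κ κ ℝ := hH.eigenvectorUnitary.1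
  have hVV : Vᵀ * V = 1 := by
    simpa [star_eq_conjTranspose, conjTranspose_eq_transpose_of_trivial] using
      Unitary.coe_star_mul_self hH.eigenvectorUnitary
  have hVV' : V * Vᵀ = 1 := mul_eq_one_comm.mp hVV
  have hcol : ∀ j, (Aᵀ * A) *ᵥ V.col j = hH.eigenvalues j • V.col j :=
    fun j => hH.mulVec_eigenvectorBasis j
  have hker : ∀ x, (Aᵀ * A) *ᵥ x = 0 ↔ A *ᵥ x = 0 := fun x => by
    simpa [conjTranspose_eq_transpose_of_trivial] using conjTranspose_mul_self_mulVec_eq_zero A x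
  set e : Fin (Fintype.card {j // hH.eigenvalues j ≠ 0}) ⊕
      Fin (Fintype.card {j // ¬ hH.eigenvalues j ≠ 0}) ≃ κ :=
    ((Fintype.equivFin _).symm.sumCongr (Fintype.equivFin _).symm).trans
      (Equiv.sumCompl fun j => hH.eigenvalues j ≠ 0)
  have hl : ∀ a, hH.eigenvalues (e (Sum.inl a)) ≠ 0 := fun a =>
    ((Fintype.equivFin {j // hH.eigenvalues j ≠ 0}).symm a).2
  have hr : ∀ a, hH.eigenvalues (e (Sum.inr a)) = 0 := fun a => not_not.mp
    ((Fintype.equivFin {j // ¬ hH.eigenvalues j ≠ 0}).symm a).2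
  set S := V.submatrix id e with hS
  have hSS : Sᵀ * S = 1 := by
    change V.transpose.submatrix e (Equiv.refl κ) * V.submatrix (Equiv.refl κ) e = 1
    rw [submatrix_mul_equiv, hVV, submatrix_one_equiv]
  have hSS' : S * Sᵀ = 1 := by
    rw [hS, transpose_submatrix, submatrix_mul_equiv, hVV', submatrix_id_id]
  refine ⟨_, _, S.toCols₁, S.toCols₂, ?_⟩
  have hSc := fromCols_toCols S
  rw [← hSc, transpose_fromCols, fromRows_mul_fromCols, ← fromBlocks_one, fromBlocks_inj] at hSS
  rw [← hSc, transpose_fromCols, fromCols_mul_fromRows] at hSS'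
  refine ⟨hSS.1, hSS.2.1, hSS.2.2.1, hSS.2.2.2, hSS', ?_, ?_⟩
  · ext i a
    have h1 : (Aᵀ * A) *ᵥ (S.toCols₂.col a) = 0 := by
      have := hcol (e (Sum.inr a))
      rw [hr, zero_smul] at this
      exact this
    exact congrFun ((hker _).mp h1) i
  · intro x hx
    have h1 : Aᵀ * A * S.toCols₁ =
        S.toCols₁ * diagonal (fun a => hH.eigenvalues (e (Sum.inl a))) := by
      ext k a
      rw [mul_diagonal, mul_comm]
      exact congrFun (hcol (e (Sum.inl a))) k
    have h2 := congrArg (S.toCols₁ᵀ *ᵥ ·) ((hker _).mpr hx)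
    simp only [mulVec_mulVec, h1, mulVec_zero] at h2
    rw [← Matrix.mul_assoc, hSS.1, Matrix.one_mul] at h2
    ext a
    have h3 := congrFun h2 a
    rw [mulVec_diagonal] at h3
    exact (mul_eq_zero.mp h3).resolve_left (hl a)

end Matrix

theorem Matrix.PosSemidef.mul_eq_zero_of_transpose_mul_mul_eq_zero {ι κ : Type*} [Fintype ι]
    {W : Matrix ι ι ℝ} (hW : W.PosSemidef) {V : Matrix ι κ ℝ} (h : Vᵀ * W * V = 0) :
    W * V = 0 := by
  ext i j
  have h1 : star (V.col j) ⬝ᵥ W *ᵥ V.col j = 0 := by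
    have h2 := congrFun (congrFun h j) j
    rw [Matrix.mul_assoc] at h2
    exact h2
  exact congrFun ((hW.dotProduct_mulVec_zero_iff _).mp h1) i

theorem Matrix.PosSemidef.posDef_transpose_mul_mul {ι κ : Type*} [Fintype ι] [Fintype κ]
    {W : Matrix ι ι ℝ} (hW : W.PosSemidef) {V : Matrix ι κ ℝ}
    (h : ∀ x, W *ᵥ (V *ᵥ x) = 0 → x = 0) : (Vᵀ * W * V).PosDef := by
  have hVWV : (Vᵀ * W * V).PosSemidef := by
    simpa [conjTranspose_eq_transpose_of_trivial] using hW.conjTranspose_mul_mul_same V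
  refine .of_dotProduct_mulVec_pos hVWV.isHermitian fun x hx => ?_
  refine lt_of_le_of_ne (hVWV.dotProduct_mulVec_nonneg x) fun h0 => hx (h x ?_)
  refine (hW.dotProduct_mulVec_zero_iff _).mp ?_
  rw [h0, star_trivial, star_trivial, Matrix.mul_assoc, ← mulVec_mulVec, ← mulVec_mulVec,
    dotProduct_mulVec x, vecMul_transpose]

theorem Matrix.isUnit_of_mulVec_eq_zero {ι : Type*} [Fintype ι] [DecidableEq ι]
    {W : Matrix ι ι ℝ} (h : ∀ x, W *ᵥ x = 0 → x = 0) : IsUnit W :=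
  Matrix.mulVec_injective_iff_isUnit.mp ((injective_iff_map_eq_zero W.mulVecLin).mpr h)

theorem Matrix.card_le_of_mulVec_eq_zero {p q : ℕ} {M : Matrix (Fin p) (Fin q) ℝ}
    (h : ∀ x, M *ᵥ x = 0 → x = 0) : q ≤ p := by
  simpa using LinearMap.finrank_le_finrank_of_injective
    ((injective_iff_map_eq_zero M.mulVecLin).mpr h)

/-! ### Existence of a staircase form -/

namespace DescriptorSystem

variable {ι κ : Type*}

/-- A common kernel vector of `E` and `J - R` would be a kernel vector of the pencil. -/
theorem IsRegular.eq_zero_of_mulVec_eq_zero [Fintype ι] [DecidableEq ι]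
    {sys : DescriptorSystem ι κ} (hreg : sys.IsRegular) {v : ι → ℝ} (hE : sys.E *ᵥ v = 0)
    (hA : (sys.J - sys.R) *ᵥ v = 0) : v = 0 := by
  by_contra hv
  refine hreg (Matrix.exists_mulVec_eq_zero_iff.mp ⟨fun i => Polynomial.C (v i), ?_, ?_⟩)
  · intro h
    exact hv (funext fun i => Polynomial.C_injective (by simpa using congrFun h i))
  · have hC : ∀ M : Matrix ι ι ℝ, M.map Polynomial.C *ᵥ (fun i => Polynomial.C (v i)) =
        fun i => Polynomial.C ((M *ᵥ v) i) := fun M => by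
      ext i : 1
      simp [Matrix.mulVec, dotProduct]
    rw [pencil, Matrix.sub_mulVec, Matrix.smul_mulVec, hC, hC, hE, hA]
    ext i : 1
    simp

/-- With `A = J - R`, the columns of `B` and `C` span the range and the kernel of `E`, those of
`C * D₄` the kernel of the compression of `A` to `ker E`, and those of `B * F₁` the image of
`C * D₄` under `J`; the orthogonal matrix `[B F₁, B F₂, C D₃, C D₄]` yields the staircase form. -/
theorem IsPortHamiltonian.exists_hasStaircaseForm [Fintype ι] [DecidableEq ι] [Fintype κ]
    {sys : DescriptorSystem ι κ} (hsys : sys.IsPortHamiltonian) (hreg : sys.IsRegular) :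
    ∃ n₁ n₂ n₃ : ℕ, sys.HasStaircaseForm n₁ n₂ n₃ := by
  obtain ⟨p, q, B, C, hBB, hBC, hCB, hCC, hsum, hEC, hEB⟩ :=
    Matrix.exists_orthogonal_kernel_splitting sys.E
  obtain ⟨n₃, n₄, D₃, D₄, h33, h34, h43, h44, hDsum, hAD, hAinj⟩ :=
    Matrix.exists_orthogonal_kernel_splitting (Cᵀ * (sys.J - sys.R) * C)
  obtain ⟨n₁, n₂, F₁, F₂, hF11, hF12, hF21, hF22, hFsum, hMF, hMinj⟩ :=
    Matrix.exists_orthogonal_kernel_splitting (Bᵀ * sys.J * (C * D₄))ᵀ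
  have hE4 : sys.E * (C * D₄) = 0 := by rw [← Matrix.mul_assoc, hEC, Matrix.zero_mul]
  -- The symmetric part of `(C * D₄)ᵀ * (J - R) * (C * D₄) = 0` vanishes, so semidefiniteness of
  -- `[R, P; Pᵀ, S]` makes both `R` and `Pᵀ` vanish on the columns of `C * D₄`.
  have hR44 : (C * D₄)ᵀ * sys.R * (C * D₄) = 0 := by
    have h1 : (C * D₄)ᵀ * (sys.J - sys.R) * (C * D₄) = 0 := by
      have : (C * D₄)ᵀ * (sys.J - sys.R) * (C * D₄) =
          D₄ᵀ * (Cᵀ * (sys.J - sys.R) * C * D₄) := by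
        simp only [Matrix.transpose_mul, Matrix.mul_assoc]
      rw [this, hAD, Matrix.mul_zero]
    rw [Matrix.mul_sub, Matrix.sub_mul, sub_eq_zero] at h1
    have h2 := hsys.transpose_mul_J_mul (C * D₄) (C * D₄)
    rw [h1, hsys.transpose_mul_R_mul] at h2
    ext i j
    exact self_eq_neg.mp (congrFun (congrFun h2 i) j)
  have hRP : sys.R * (C * D₄) = 0 ∧ sys.Pᵀ * (C * D₄) = 0 := by
    have h1 := hsys.posSemidef_W.mul_eq_zero_of_transpose_mul_mul_eq_zero
      (V := Matrix.fromRows (C * D₄) 0) (by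
        rw [Matrix.mul_assoc, Matrix.fromBlocks_mul_fromRows, Matrix.transpose_fromRows,
          Matrix.fromCols_mul_fromRows]
        simpa [Matrix.mul_assoc] using hR44)
    rw [Matrix.fromBlocks_mul_fromRows, ← Matrix.fromRows_zero] at h1
    simpa using Matrix.fromRows_inj h1
  obtain ⟨hR4, hPT4⟩ := hRP
  have hR4' : (C * D₄)ᵀ * sys.R = 0 := by
    simpa only [Matrix.transpose_mul, hsys.transpose_R, Matrix.transpose_zero] using
      congrArg Matrix.transpose hR4
  have hP4 : (C * D₄)ᵀ * sys.P = 0 := by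
    simpa only [Matrix.transpose_mul, Matrix.transpose_transpose, Matrix.transpose_zero] using
      congrArg Matrix.transpose hPT4
  -- `J` maps the columns of `C * D₄` into the range of `E`, and does so injectively by regularity.
  have hCJ : Cᵀ * sys.J * (C * D₄) = 0 := by
    have h1 : Cᵀ * sys.J * (C * D₄) =
        Cᵀ * (sys.J - sys.R) * C * D₄ + Cᵀ * (sys.R * (C * D₄)) := by
      simp only [Matrix.mul_sub, Matrix.sub_mul, Matrix.mul_assoc]
      abel
    rw [h1, hAD, hR4, Matrix.mul_zero, add_zero]
  have hJC : (C * D₄)ᵀ * sys.J * C = 0 := by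
    rw [← neg_eq_zero, ← hsys.transpose_mul_J_mul, hCJ, Matrix.transpose_zero]
  have hinj : ∀ x, (Bᵀ * sys.J * (C * D₄)) *ᵥ x = 0 → x = 0 := by
    intro x hx
    have hJ0 : (sys.J * (C * D₄)) *ᵥ x = 0 := by
      have h1 : sys.J * (C * D₄) = B * (Bᵀ * sys.J * (C * D₄)) := by
        have h2 : sys.J * (C * D₄) = (B * Bᵀ + C * Cᵀ) * (sys.J * (C * D₄)) := by
          rw [hsum, Matrix.one_mul]
        have h3 : (B * Bᵀ + C * Cᵀ) * (sys.J * (C * D₄)) =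
            B * (Bᵀ * sys.J * (C * D₄)) + C * (Cᵀ * sys.J * (C * D₄)) := by
          simp only [Matrix.add_mul, Matrix.mul_assoc]
        rw [h2, h3, hCJ, Matrix.mul_zero, add_zero]
      rw [h1, ← Matrix.mulVec_mulVec, hx, Matrix.mulVec_zero]
    have h0 : (C * D₄) *ᵥ x = 0 := by
      refine hreg.eq_zero_of_mulVec_eq_zero ?_ ?_
      · rw [Matrix.mulVec_mulVec, hE4, Matrix.zero_mulVec]
      · rw [Matrix.mulVec_mulVec, Matrix.sub_mul, hR4, sub_zero, hJ0]
    have h1 : (D₄ᵀ * Cᵀ) * (C * D₄) = 1 := by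
      rw [Matrix.mul_assoc, ← Matrix.mul_assoc Cᵀ, hCC, Matrix.one_mul, h44]
    have h2 := congrArg ((D₄ᵀ * Cᵀ) *ᵥ ·) h0
    simpa only [Matrix.mulVec_mulVec, h1, Matrix.one_mulVec, Matrix.mulVec_zero] using h2
  have hF2 : F₂ᵀ * (Bᵀ * sys.J * (C * D₄)) = 0 := by
    have h1 := congrArg Matrix.transpose hMF
    rwa [Matrix.transpose_mul, Matrix.transpose_transpose, Matrix.transpose_zero] at h1
  have hinj' : ∀ x, (F₁ᵀ * (Bᵀ * sys.J * (C * D₄))) *ᵥ x = 0 → x = 0 := by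
    intro x hx
    refine hinj x ?_
    have h1 : Bᵀ * sys.J * (C * D₄) = F₁ * (F₁ᵀ * (Bᵀ * sys.J * (C * D₄))) := by
      rw [← Matrix.mul_assoc F₁, ← add_zero (F₁ * F₁ᵀ * _), ← Matrix.mul_zero F₂, ← hF2,
        ← Matrix.mul_assoc F₂, ← Matrix.add_mul, hFsum, Matrix.one_mul]
    rw [h1, ← Matrix.mulVec_mulVec, hx, Matrix.mulVec_zero]
  have hMinj' : ∀ x, ((Bᵀ * sys.J * (C * D₄))ᵀ * F₁) *ᵥ x = 0 → x = 0 := fun x hx =>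
    hMinj x (by rwa [Matrix.mulVec_mulVec])
  -- `F₁ᵀ * (Bᵀ * J * (C * D₄))` and its transpose are injective, so this matrix is square.
  obtain rfl : n₁ = n₄ := le_antisymm (Matrix.card_le_of_mulVec_eq_zero hMinj')
    (Matrix.card_le_of_mulVec_eq_zero hinj')
  have hBB' : ∀ {k : ℕ} (N : Matrix (Fin p) (Fin k) ℝ), Bᵀ * (B * N) = N := fun N => by
    rw [← Matrix.mul_assoc, hBB, Matrix.one_mul]
  have hCC' : ∀ {k : ℕ} (N : Matrix (Fin q) (Fin k) ℝ), Cᵀ * (C * N) = N := fun N => by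
    rw [← Matrix.mul_assoc, hCC, Matrix.one_mul]
  have hBC' : ∀ {k : ℕ} (N : Matrix (Fin q) (Fin k) ℝ), Bᵀ * (C * N) = 0 := fun N => by
    rw [← Matrix.mul_assoc, hBC, Matrix.zero_mul]
  have hCB' : ∀ {k : ℕ} (N : Matrix (Fin p) (Fin k) ℝ), Cᵀ * (B * N) = 0 := fun N => by
    rw [← Matrix.mul_assoc, hCB, Matrix.zero_mul]
  have hE3 : sys.E * (C * D₃) = 0 := by rw [← Matrix.mul_assoc, hEC, Matrix.zero_mul]
  have hEK : sys.E * Matrix.fromCols (C * D₃) (C * D₄) = 0 := by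
    rw [Matrix.mul_fromCols, hE3, hE4, Matrix.fromCols_zero]
  have hKE : (Matrix.fromCols (C * D₃) (C * D₄))ᵀ * sys.E = 0 := by
    have h1 := congrArg Matrix.transpose hEK
    rwa [Matrix.transpose_mul, hsys.transpose_E, Matrix.transpose_zero] at h1
  have hJ43 : (C * D₄)ᵀ * sys.J * (C * D₃) = 0 := by
    rw [← Matrix.mul_assoc, hJC, Matrix.zero_mul]
  have hJ44 : (C * D₄)ᵀ * sys.J * (C * D₄) = 0 := by
    rw [← Matrix.mul_assoc, hJC, Matrix.zero_mul]
  have hJ34 : (C * D₃)ᵀ * sys.J * (C * D₄) = 0 := by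
    rw [Matrix.transpose_mul, Matrix.mul_assoc, Matrix.mul_assoc, ← Matrix.mul_assoc Cᵀ, hCJ,
      Matrix.mul_zero]
  have hJ24 : (B * F₂)ᵀ * sys.J * (C * D₄) = 0 := by
    rw [Matrix.transpose_mul, Matrix.mul_assoc, Matrix.mul_assoc, ← Matrix.mul_assoc Bᵀ, hF2]
  have hJ42 : (C * D₄)ᵀ * sys.J * (B * F₂) = 0 := by
    rw [← neg_eq_zero, ← hsys.transpose_mul_J_mul, hJ24, Matrix.transpose_zero]
  have hA33 : IsUnit ((C * D₃)ᵀ * sys.J * (C * D₃) - (C * D₃)ᵀ * sys.R * (C * D₃)) := by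
    have h4A : D₄ᵀ * (Cᵀ * (sys.J - sys.R) * C) = 0 := by
      have h1 : D₄ᵀ * (Cᵀ * (sys.J - sys.R) * C) =
          (C * D₄)ᵀ * sys.J * C - (C * D₄)ᵀ * sys.R * C := by
        simp only [Matrix.transpose_mul, Matrix.mul_sub, Matrix.sub_mul, Matrix.mul_assoc]
      rw [h1, hJC, hR4', Matrix.zero_mul, sub_zero]
    have h3A : Cᵀ * (sys.J - sys.R) * C = D₃ * (D₃ᵀ * (Cᵀ * (sys.J - sys.R) * C)) := by
      rw [← add_zero (D₃ * (D₃ᵀ * _)), ← Matrix.mul_zero D₄, ← h4A, ← Matrix.mul_assoc D₃,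
        ← Matrix.mul_assoc D₄, ← Matrix.add_mul, hDsum, Matrix.one_mul]
    have h1 : (C * D₃)ᵀ * sys.J * (C * D₃) - (C * D₃)ᵀ * sys.R * (C * D₃) =
        D₃ᵀ * (Cᵀ * (sys.J - sys.R) * C) * D₃ := by
      simp only [Matrix.transpose_mul, Matrix.mul_sub, Matrix.sub_mul, Matrix.mul_assoc]
    rw [h1]
    refine Matrix.isUnit_of_mulVec_eq_zero fun x hx => hAinj x ?_
    rw [h3A, ← Matrix.mulVec_mulVec, Matrix.mulVec_mulVec x, hx, Matrix.mulVec_zero]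
  have hJ41 : IsUnit ((C * D₄)ᵀ * sys.J * (B * F₁)) := by
    have h1 : (C * D₄)ᵀ * sys.J * (B * F₁) = -((Bᵀ * sys.J * (C * D₄))ᵀ * F₁) := by
      rw [hsys.transpose_mul_J_mul, Matrix.neg_mul, neg_neg, Matrix.mul_assoc _ B]
    rw [h1]
    exact (Matrix.isUnit_of_mulVec_eq_zero hMinj').neg
  have hE₀ : ((Matrix.fromCols (B * F₁) (B * F₂))ᵀ * sys.E *
      Matrix.fromCols (B * F₁) (B * F₂)).PosDef := by
    refine hsys.posSemidef_E.posDef_transpose_mul_mul fun x hx => ?_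
    rw [← Matrix.mul_fromCols, ← Matrix.mulVec_mulVec] at hx
    have h1 := congrArg ((Matrix.fromCols F₁ F₂)ᵀ *ᵥ ·) (hEB _ hx)
    simpa only [Matrix.mulVec_mulVec, Matrix.transpose_fromCols, Matrix.fromRows_mul_fromCols,
      hF11, hF12, hF21, hF22, Matrix.fromBlocks_one, Matrix.one_mulVec, Matrix.mulVec_zero]
      using h1
  refine ⟨n₁, n₂, n₃,
    Matrix.fromCols (Matrix.fromCols (B * F₁) (B * F₂)) (Matrix.fromCols (C * D₃) (C * D₄)),
    ?_, ?_, ⟨_, hE₀, ?_⟩, ?_, ?_⟩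
  · simp only [Matrix.transpose_fromCols, Matrix.fromRows_mul_fromCols, Matrix.transpose_mul,
      Matrix.mul_assoc, hBB', hCC', hBC', hCB', hF11, hF12, hF21, hF22, h33, h34, h43, h44,
      Matrix.mul_zero, Matrix.fromBlocks_zero, Matrix.fromBlocks_one]
  · simp only [Matrix.transpose_fromCols, Matrix.fromCols_mul_fromRows, Matrix.transpose_mul]
    have h1 : B * (F₁ * F₁ᵀ + F₂ * F₂ᵀ) * Bᵀ + C * (D₃ * D₃ᵀ + D₄ * D₄ᵀ) * Cᵀ = 1 := by
      rw [hFsum, hDsum, Matrix.mul_one, Matrix.mul_one, hsum]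
    rw [← h1]
    simp only [Matrix.mul_add, Matrix.add_mul, Matrix.mul_assoc]
  · rw [Matrix.transpose_fromCols_mul_mul_fromCols, hKE,
      Matrix.mul_assoc _ sys.E (Matrix.fromCols (C * D₃) (C * D₄)), hEK]
    simp
  · refine ⟨(B * F₁)ᵀ * sys.J * (B * F₁), (B * F₁)ᵀ * sys.J * (B * F₂),
      (B * F₁)ᵀ * sys.J * (C * D₃), (B * F₁)ᵀ * sys.J * (C * D₄),
      (B * F₂)ᵀ * sys.J * (B * F₁), (B * F₂)ᵀ * sys.J * (B * F₂), (B * F₂)ᵀ * sys.J * (C * D₃),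
      (C * D₃)ᵀ * sys.J * (B * F₁), (C * D₃)ᵀ * sys.J * (B * F₂), (C * D₃)ᵀ * sys.J * (C * D₃),
      (C * D₄)ᵀ * sys.J * (B * F₁),
      (B * F₁)ᵀ * sys.R * (B * F₁), (B * F₁)ᵀ * sys.R * (B * F₂), (B * F₁)ᵀ * sys.R * (C * D₃),
      (B * F₂)ᵀ * sys.R * (B * F₁), (B * F₂)ᵀ * sys.R * (B * F₂), (B * F₂)ᵀ * sys.R * (C * D₃),
      (C * D₃)ᵀ * sys.R * (B * F₁), (C * D₃)ᵀ * sys.R * (B * F₂), (C * D₃)ᵀ * sys.R * (C * D₃),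
      ?_, ?_, hA33, hJ41⟩
    · simp only [Matrix.transpose_fromCols_mul_mul_fromCols, hJ24, hJ42, hJ34, hJ43, hJ44]
    · simp only [Matrix.transpose_fromCols_mul_mul_fromCols, hR4', Matrix.zero_mul,
        Matrix.mul_assoc _ sys.R (C * D₄), hR4, Matrix.mul_zero]
  · exact ⟨(B * F₁)ᵀ * sys.P, (B * F₂)ᵀ * sys.P, (C * D₃)ᵀ * sys.P, by
      simp only [Matrix.transpose_fromCols, Matrix.fromRows_mul, hP4]⟩

end DescriptorSystem

/-! ### The proper part from a staircase form -/

namespace DescriptorSystem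

variable {ι κ : Type*}

/-- In staircase coordinates the fourth block row gives `x₁ = X u`, the third one gives `x₃` in terms
of `x₁`, `x₂` and `u`, and the first one only determines the multiplier `x₄`. Substituting
`x₂ = z + Y u` with `E₂₂ Y = -E₂₁ X` removes the derivative of `u` from the second block row. -/
theorem HasStaircaseForm.exists_properPart [Fintype ι] [DecidableEq ι] [Fintype κ] [DecidableEq κ]
    {sys : DescriptorSystem ι κ} (hsys : sys.IsPortHamiltonian) (hreg : sys.IsRegular)
    {n₁ n₂ n₃ : ℕ} (h : sys.HasStaircaseForm n₁ n₂ n₃) :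
    ∃ sysp : DescriptorSystem (Fin n₂) κ, sysp.IsPortHamiltonian ∧ sysp.E.PosDef ∧
      IsProperPart sys.transferFunction sysp.transferFunction := by
  obtain ⟨T, -, hTT, ⟨E₀, hE₀, hE⟩, ⟨J₁₁, J₁₂, J₁₃, J₁₄, J₂₁, J₂₂, J₂₃, J₃₁, J₃₂, J₃₃, J₄₁,
    R₁₁, R₁₂, R₁₃, R₂₁, R₂₂, R₂₃, R₃₁, R₃₂, R₃₃, hJ, hR, h33, h41⟩, ⟨P₁, P₂, P₃, hP⟩⟩ := h
  obtain ⟨T₁, T₂, T₃, T₄, rfl⟩ : ∃ T₁ T₂ T₃ T₄,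
      T = Matrix.fromCols (Matrix.fromCols T₁ T₂) (Matrix.fromCols T₃ T₄) :=
    ⟨T.toCols₁.toCols₁, T.toCols₁.toCols₂, T.toCols₂.toCols₁, T.toCols₂.toCols₂, by
      simp only [Matrix.fromCols_toCols]⟩
  have hEK : sys.E * Matrix.fromCols T₃ T₄ = 0 := by
    have h1 := congrArg Matrix.toCols₂ hE
    rw [Matrix.mul_fromCols, Matrix.toCols₂_fromCols, ← Matrix.fromCols_fromRows_eq_fromBlocks,
      Matrix.toCols₂_fromCols, Matrix.fromRows_zero, Matrix.mul_assoc] at h1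
    rw [← Matrix.one_mul (sys.E * _), ← hTT, Matrix.mul_assoc, h1, Matrix.mul_zero]
  have hE3 : sys.E * T₃ = 0 ∧ sys.E * T₄ = 0 := by
    rw [Matrix.mul_fromCols, ← Matrix.fromCols_zero] at hEK
    exact Matrix.fromCols_inj hEK
  obtain ⟨hE3, hE4⟩ := hE3
  have hE22 : (T₂ᵀ * sys.E * T₂).PosDef := by
    have h1 : T₂ᵀ * sys.E * T₂ = E₀.submatrix Sum.inr Sum.inr := by
      rw [Matrix.transpose_fromCols_mul_mul_fromCols, Matrix.fromBlocks_inj,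
        Matrix.transpose_fromCols_mul_mul_fromCols] at hE
      rw [← hE.1]
      rfl
    rw [h1]
    exact hE₀.submatrix Sum.inr_injective
  simp only [Matrix.transpose_fromCols_mul_mul_fromCols, Matrix.fromBlocks_inj] at hJ hR
  obtain ⟨⟨-, -, -, -⟩, ⟨-, -, -, hJ24⟩, ⟨-, -, hJ41, hJ42⟩, ⟨hJ33, hJ34, hJ43, hJ44⟩⟩ := hJ
  obtain ⟨⟨-, -, -, -⟩, ⟨-, hR14, -, hR24⟩, ⟨-, -, hR41, hR42⟩, ⟨hR33, hR34, hR43, hR44⟩⟩ := hR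
  have hP4 : T₄ᵀ * sys.P = 0 := by
    simp only [Matrix.transpose_fromCols, Matrix.fromRows_mul] at hP
    exact (Matrix.fromRows_inj (Matrix.fromRows_inj hP).2).2
  have hA33 : IsUnit (T₃ᵀ * (sys.J - sys.R) * T₃).det := by
    rwa [Matrix.mul_sub, Matrix.sub_mul, hJ33, hR33, ← Matrix.isUnit_iff_isUnit_det]
  have hA41 : IsUnit (T₄ᵀ * (sys.J - sys.R) * T₁).det := by
    rwa [Matrix.mul_sub, Matrix.sub_mul, hJ41, hR41, sub_zero, ← Matrix.isUnit_iff_isUnit_det]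
  have hA42 : T₄ᵀ * (sys.J - sys.R) * T₂ = 0 := by
    rw [Matrix.mul_sub, Matrix.sub_mul, hJ42, hR42, sub_zero]
  have hA43 : T₄ᵀ * (sys.J - sys.R) * T₃ = 0 := by
    rw [Matrix.mul_sub, Matrix.sub_mul, hJ43, hR43, sub_zero]
  have hA44 : T₄ᵀ * (sys.J - sys.R) * T₄ = 0 := by
    rw [Matrix.mul_sub, Matrix.sub_mul, hJ44, hR44, sub_zero]
  have hA24 : T₂ᵀ * (sys.J - sys.R) * T₄ = 0 := by
    rw [Matrix.mul_sub, Matrix.sub_mul, hJ24, hR24, sub_zero]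
  have hA34 : T₃ᵀ * (sys.J - sys.R) * T₄ = 0 := by
    rw [Matrix.mul_sub, Matrix.sub_mul, hJ34, hR34, sub_zero]
  have hA14 : T₁ᵀ * (sys.J - sys.R) * T₄ = -(T₄ᵀ * (sys.J - sys.R) * T₁)ᵀ := by
    rw [Matrix.mul_sub, Matrix.sub_mul, hR14, sub_zero, Matrix.mul_sub, Matrix.sub_mul, hR41,
      sub_zero, hsys.transpose_mul_J_mul, neg_neg]
  -- The coefficients of the ansatz `x₁ = X u`, `x₂ = z + Y u`, `x₃ = Z z + W u`.
  set A := sys.J - sys.R with hAdef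
  set X : Matrix (Fin n₁) κ ℝ := -((T₄ᵀ * A * T₁)⁻¹ * (T₄ᵀ * sys.G)) with hXdef
  have hX : T₄ᵀ * A * T₁ * X = -(T₄ᵀ * sys.G) := by
    rw [hXdef, Matrix.mul_neg, Matrix.mul_nonsing_inv_cancel_left _ _ hA41]
  set Y : Matrix (Fin n₂) κ ℝ := -((T₂ᵀ * sys.E * T₂)⁻¹ * (T₂ᵀ * sys.E * T₁ * X)) with hYdef
  have hY : T₂ᵀ * sys.E * T₂ * Y = -(T₂ᵀ * sys.E * T₁ * X) := by
    rw [hYdef, Matrix.mul_neg, Matrix.mul_nonsing_inv_cancel_left _ _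
      ((Matrix.isUnit_iff_isUnit_det _).mp hE22.isUnit)]
  set Z : Matrix (Fin n₃) (Fin n₂) ℝ := -((T₃ᵀ * A * T₃)⁻¹ * (T₃ᵀ * A * T₂)) with hZdef
  have hZ : T₃ᵀ * A * T₃ * Z = -(T₃ᵀ * A * T₂) := by
    rw [hZdef, Matrix.mul_neg, Matrix.mul_nonsing_inv_cancel_left _ _ hA33]
  set W : Matrix (Fin n₃) κ ℝ := -((T₃ᵀ * A * T₃)⁻¹ *
    (T₃ᵀ * (A * (T₁ * X + T₂ * Y) + (sys.G - sys.P)))) with hWdef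
  have hW : T₃ᵀ * A * T₃ * W = -(T₃ᵀ * (A * (T₁ * X + T₂ * Y) + (sys.G - sys.P))) := by
    rw [hWdef, Matrix.mul_neg, Matrix.mul_nonsing_inv_cancel_left _ _ hA33]
  set Q := T₂ + T₃ * Z with hQ
  set L := T₁ * X + T₂ * Y + T₃ * W with hL
  have h3E : T₃ᵀ * sys.E = 0 := by
    have := congrArg Matrix.transpose hE3
    rwa [Matrix.transpose_mul, hsys.transpose_E, Matrix.transpose_zero] at this
  have hQE : Qᵀ * sys.E = T₂ᵀ * sys.E := by
    rw [hQ, Matrix.transpose_add, Matrix.transpose_mul, Matrix.add_mul, Matrix.mul_assoc, h3E,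
      Matrix.mul_zero, add_zero]
  have hQEQ : Qᵀ * sys.E * Q = T₂ᵀ * sys.E * T₂ := by
    rw [hQE, hQ, Matrix.mul_add, Matrix.mul_assoc _ _ (T₃ * Z), ← Matrix.mul_assoc _ T₃, hE3,
      Matrix.zero_mul, Matrix.mul_zero, add_zero]
  have hQEL : Qᵀ * (sys.E * L) = 0 := by
    have h1 : Qᵀ * (sys.E * L) = T₂ᵀ * sys.E * T₁ * X + T₂ᵀ * sys.E * T₂ * Y +
        T₂ᵀ * ((sys.E * T₃) * W) := by
      rw [← Matrix.mul_assoc, hQE, hL]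
      simp only [Matrix.mul_add, Matrix.mul_assoc]
    rw [h1, hY, hE3]
    simp
  have h3AQ : T₃ᵀ * (A * Q) = 0 := by
    have h1 : T₃ᵀ * (A * Q) = T₃ᵀ * A * T₂ + T₃ᵀ * A * T₃ * Z := by
      rw [hQ]; simp only [Matrix.mul_add, Matrix.mul_assoc]
    rw [h1, hZ, add_neg_cancel]
  have h4AQ : T₄ᵀ * (A * Q) = 0 := by
    have h1 : T₄ᵀ * (A * Q) = T₄ᵀ * A * T₂ + T₄ᵀ * A * T₃ * Z := by
      rw [hQ]; simp only [Matrix.mul_add, Matrix.mul_assoc]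
    rw [h1, hA42, hA43, Matrix.zero_mul, add_zero]
  have h3B : T₃ᵀ * (A * L + (sys.G - sys.P)) = 0 := by
    have h1 : T₃ᵀ * (A * L + (sys.G - sys.P)) =
        T₃ᵀ * (A * (T₁ * X + T₂ * Y) + (sys.G - sys.P)) + T₃ᵀ * A * T₃ * W := by
      rw [hL]; simp only [Matrix.mul_add, Matrix.mul_assoc]; abel
    rw [h1, hW, add_neg_cancel]
  have h4B : T₄ᵀ * (A * L + (sys.G - sys.P)) = 0 := by
    have h1 : T₄ᵀ * (A * L + (sys.G - sys.P)) = T₄ᵀ * A * T₁ * X + T₄ᵀ * A * T₂ * Y +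
        T₄ᵀ * A * T₃ * W + T₄ᵀ * sys.G - T₄ᵀ * sys.P := by
      rw [hL]; simp only [Matrix.mul_add, Matrix.mul_sub, Matrix.mul_assoc]; abel
    rw [h1, hX, hA42, hA43, hP4]
    simp
  have hQA4 : Qᵀ * (A * T₄) = 0 := by
    have h1 : Qᵀ * (A * T₄) = T₂ᵀ * A * T₄ + Zᵀ * (T₃ᵀ * A * T₄) := by
      rw [hQ]
      simp only [Matrix.transpose_add, Matrix.transpose_mul, Matrix.add_mul, Matrix.mul_assoc]
    rw [h1, hA24, hA34, Matrix.mul_zero, add_zero]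
  have hCM : (sys.G + sys.P)ᵀ * T₄ = Lᵀ * (A * T₄) := by
    have h1 : Lᵀ * (A * T₄) = Xᵀ * (T₁ᵀ * A * T₄) + Yᵀ * (T₂ᵀ * A * T₄) +
        Wᵀ * (T₃ᵀ * A * T₄) := by
      rw [hL]
      simp only [Matrix.transpose_add, Matrix.transpose_mul, Matrix.add_mul, Matrix.mul_assoc]
    have h2 : sys.Pᵀ * T₄ = 0 := by
      simpa using congrArg Matrix.transpose hP4
    rw [h1, hA24, hA34, hA14, Matrix.mul_zero, Matrix.mul_zero, add_zero, add_zero,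
      Matrix.mul_neg, ← Matrix.transpose_mul, hX, Matrix.transpose_neg, neg_neg,
      Matrix.transpose_mul, Matrix.transpose_transpose, Matrix.transpose_add, Matrix.add_mul, h2,
      add_zero]
  refine ⟨sys.congruence Q L, hsys.congruence Q L, ?_, ?_⟩
  · change (Qᵀ * sys.E * Q).PosDef
    rwa [hQEQ]
  -- `T₂ᵀ = Qᵀ - Zᵀ T₃ᵀ`, so `T Tᵀ = 1` expresses the identity through `T₁ᵀ`, `Qᵀ`, `T₃ᵀ`, `T₄ᵀ`.
  refine isProperPart_congruence hsys hreg (M := T₄) (U := T₁) (V₁ := T₁) (V₂ := T₂)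
    (K := Matrix.fromCols T₃ T₄) (V₃ := Matrix.fromCols (T₃ - T₂ * Zᵀ) T₄)
    hE4 hEK ?_ ?_ ?_ hQEL hQA4 ?_ ?_ hCM ?_
  · rw [Matrix.transpose_fromCols, Matrix.fromRows_mul, h3AQ, h4AQ, Matrix.fromRows_zero]
  · rw [Matrix.transpose_fromCols, Matrix.fromRows_mul, ← Matrix.mul_assoc, ← Matrix.mul_assoc,
      hA34, hA44, Matrix.fromRows_zero]
  · rw [Matrix.transpose_fromCols, Matrix.fromRows_mul, h3B, h4B, Matrix.fromRows_zero]
  · rw [← Matrix.mul_assoc, hA14, Matrix.isUnit_iff_isUnit_det, Matrix.det_neg,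
      Matrix.det_transpose]
    exact ((isUnit_one.neg).pow _).mul hA41
  · rw [Matrix.transpose_fromCols, Matrix.fromCols_mul_fromRows, Matrix.transpose_fromCols,
      Matrix.transpose_fromCols, Matrix.fromCols_mul_fromRows, Matrix.fromCols_mul_fromRows]
      at hTT
    rw [Matrix.transpose_fromCols, Matrix.fromCols_mul_fromRows, hQ, ← hTT]
    simp only [Matrix.transpose_add, Matrix.transpose_mul, Matrix.mul_add, Matrix.sub_mul,
      Matrix.mul_assoc]
    abel
  · rw [hQEQ]
    exact hE22.det_pos.ne'

end DescriptorSystem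

theorem mainTheorem2 {n m : ℕ} (sys : DescriptorSystem (Fin n) (Fin m))
    (hsys : sys.IsPortHamiltonian) (hreg : sys.IsRegular) :
    (∃ n₁ n₂ n₃ : ℕ, sys.HasStaircaseForm n₁ n₂ n₃) ∧
    ∀ n₁ n₂ n₃ : ℕ, sys.HasStaircaseForm n₁ n₂ n₃ →
      ∃ sysp : DescriptorSystem (Fin n₂) (Fin m),
        sysp.IsPortHamiltonian ∧ sysp.E.PosDef ∧
        IsProperPart sys.transferFunction sysp.transferFunction := by
  exact ⟨hsys.exists_hasStaircaseForm hreg, fun _ _ _ h => h.exists_properPart hsys hreg⟩
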